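/- Let $A=(a_1,\ldots,a_n)$ be points of $\mathbb{R}^d$, not necessarily distinct, whose affine span is $\mathbb{R}^d$. Put $v_i=(a_i,1)\in\mathbb{R}^{d+1}$ and $Z(V)=\sum_{i=1}^n[0,v_i]$. For disjoint $I,B\subseteq[n]$ put $\Pi_{I,B}=\sum_{i\in I}v_i+\sum_{b\in B}[0,v_b]$; its faces are the sets $\Pi_{J,C}$ with $C\subseteq B$, $I\subseteq J\subseteq I\cup B$ and $J\cap C=\varnothing$. A fine zonotopal tiling of $Z(V)$ is a collection $\mathcal{P}$ of tiles $\Pi_{I,B}$ (each given with its pair of disjoint index sets $(I,B)$), where $|B|=d+1$ and $(a_b)_{b\in B}$ is affinely independent, whose union is $Z(V)$ and any two of which are disjoint or intersect in a common face $\Pi_{J,C}$, with the same index sets $(J,C)$ in both tiles. A subdivision of a region $R\subseteq\mathbb{R}^d$ is a collection of $d$-dimensional convex polytopes with vertices in $A$ whose union is $R$, any two of which intersect in a common (possibly empty) face; it is a triangulation if all the polytopes are simplices. We say that possibly empty, not necessarily convex regions subdivide $R$ if their union is $R$, their interiors are pairwise disjoint, and each of them has a subdivision such that these subdivisions together form a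 subdivision of $R$. Let $\mathcal{P}$ be a fine zonotopal tiling of $Z(V)$ and let $Q\subseteq[n]$, $k=|Q|$. For $r\ge 0$ let $$\mathcal{E}^{(r)}(Q)=\{\Pi_{I,B}\in\mathcal{P}:\ |I|=r,\ B\cap Q=\varnothing,\ I\subseteq Q\},\qquad \mathcal{T}^{(r)}(Q)=\{\mathrm{ch}(\{a_b\}_{b\in B}):\ \Pi_{I,B}\in\mathcal{E}^{(r)}(Q)\},$$ let $E^{(r)}(Q)$ be the union of the simplices in $\mathcal{T}^{(r)}(Q)$, and let $\mathcal{R}(Q)=E^{(k)}(Q)$ be the link region of $Q$. Let $\mathrm{ch}_Q(A)=\mathrm{ch}(\{a_i\}_{i\notin Q})$. Then: (i) for every $r\ge 0$, $\mathcal{T}^{(r)}(Q)$ is a triangulation of $E^{(r)}(Q)$; (ii) if $\{a_i\}_{i\notin Q}$ affinely spans $\mathbb{R}^d$ (or $Q=[n]$), the regions $E^{(r)}(Q)$, $r\ge 0$, subdivide $\mathrm{ch}_Q(A)$; (iii) under the same condition, $\bigcup_{r\ge 0}\mathcal{T}^{(r)}(Q)$ is a triangulation of $\mathrm{ch}_Q(A)$;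 (iv) $\mathcal{T}^{(k)}(Q)$ is a triangulation of the link region $\mathcal{R}(Q)$. In all four parts the vertices of the polytopes are among the points $a_i$ with $i\notin Q$. -/

import Mathlib

noncomputable section

namespace LinkTiling

variable {d n : ℕ}

/-- The projective lift `(p, 1)` of a point `p ∈ ℝ^d`; the space `ℝ^d × ℝ` plays the role of
`ℝ^(d+1)`. -/
def lift (p : EuclideanSpace ℝ (Fin d)) : EuclideanSpace ℝ (Fin d) × ℝ := (p, 1)

/-- The parallelepiped `Π_{I,B} = ∑_{i ∈ I} v_i + ∑_{b ∈ B} [0, v_b]`, where `v_i = (a_i, 1)`. -/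
def tile (a : Fin n → EuclideanSpace ℝ (Fin d)) (I B : Finset (Fin n)) :
    Set (EuclideanSpace ℝ (Fin d) × ℝ) :=
  {x | ∃ α : Fin n → ℝ, (∀ b ∈ B, α b ∈ Set.Icc (0 : ℝ) 1) ∧
    x = ∑ i ∈ I, lift (a i) + ∑ b ∈ B, α b • lift (a b)}

/-- The zonotope `Z(V) = ∑_{i=1}^n [0, v_i]`. -/
def zonotope (a : Fin n → EuclideanSpace ℝ (Fin d)) : Set (EuclideanSpace ℝ (Fin d) × ℝ) :=
  {x | ∃ α : Fin n → ℝ, (∀ i, α i ∈ Set.Icc (0 : ℝ) 1) ∧ x = ∑ i, α i • lift (a i)}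

/-- `Π_{J,C}` is a face of `Π_{I,B}`: it arises from `Π_{I,B}` by fixing the coefficients of the
segments `[0, v_b]`, `b ∈ B \ C`, to be `1` for `b ∈ J` and `0` for `b ∉ J`. -/
def IsTileFace (J C I B : Finset (Fin n)) : Prop :=
  C ⊆ B ∧ I ⊆ J ∧ J ⊆ I ∪ B ∧ Disjoint J C

/-- A fine zonotopal tiling of `Z(V)`: a collection of full-dimensional parallelepipeds `Π_{I,B}`,
each given by its pair of index sets `(I, B)`, that cover `Z(V)` and meet face to face. The common
faces are faces `Π_{J,C}` with the same index sets `(J, C)` in both tiles. -/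
structure IsFineZonotopalTiling (a : Fin n → EuclideanSpace ℝ (Fin d))
    (P : Set (Finset (Fin n) × Finset (Fin n))) : Prop where
  disjoint : ∀ t ∈ P, Disjoint t.1 t.2
  card_eq : ∀ t ∈ P, t.2.card = d + 1
  affineIndependent : ∀ t ∈ P, AffineIndependent ℝ (fun b : t.2 => a b)
  cover : ⋃ t ∈ P, tile a t.1 t.2 = zonotope a
  face_to_face : ∀ t ∈ P, ∀ t' ∈ P,
    tile a t.1 t.2 ∩ tile a t'.1 t'.2 = ∅ ∨
      ∃ J C : Finset (Fin n), IsTileFace J C t.1 t.2 ∧ IsTileFace J C t'.1 t'.2 ∧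
        tile a t.1 t.2 ∩ tile a t'.1 t'.2 = tile a J C

/-- `𝒯` is a subdivision of the region `R`, with vertices in the point set `A`: a collection of
`d`-dimensional polytopes with vertices in `A`, with union `R`, any two of which meet in a common,
possibly empty, face. -/
structure IsSubdivision (A : Set (EuclideanSpace ℝ (Fin d))) (R : Set (EuclideanSpace ℝ (Fin d)))
    (𝒯 : Set (Set (EuclideanSpace ℝ (Fin d)))) : Prop where
  polytope : ∀ Δ ∈ 𝒯, ∃ s : Finset (EuclideanSpace ℝ (Fin d)),
    (s : Set (EuclideanSpace ℝ (Fin d))) ⊆ A ∧ Δ = convexHull ℝ (s : Set _)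
  full_dim : ∀ Δ ∈ 𝒯, affineSpan ℝ Δ = ⊤
  cover : ⋃₀ 𝒯 = R
  face_to_face : ∀ Δ ∈ 𝒯, ∀ Δ' ∈ 𝒯, IsExposed ℝ Δ (Δ ∩ Δ') ∧ IsExposed ℝ Δ' (Δ ∩ Δ')

/-- A triangulation is a subdivision all of whose polytopes are simplices. -/
structure IsTriangulation (A : Set (EuclideanSpace ℝ (Fin d)))
    (R : Set (EuclideanSpace ℝ (Fin d)))
    (𝒯 : Set (Set (EuclideanSpace ℝ (Fin d)))) : Prop extends IsSubdivision A R 𝒯 where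
  simplex : ∀ Δ ∈ 𝒯, ∃ s : Finset (EuclideanSpace ℝ (Fin d)),
    (s : Set (EuclideanSpace ℝ (Fin d))) ⊆ A ∧
      AffineIndependent ℝ ((↑) : s → EuclideanSpace ℝ (Fin d)) ∧ Δ = convexHull ℝ (s : Set _)

/-- The (not necessarily convex, possibly empty) polyhedral regions `E r` subdivide `R`: they cover
`R`, their interiors are pairwise disjoint, and each is a union of `d`-dimensional polytopes with
vertices in `A` in such a way that any two of all these polytopes, also when they lie in different
regions, meet in a common face. -/
structure IsRegionSubdivision (A : Set (EuclideanSpace ℝ (Fin d)))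
    (R : Set (EuclideanSpace ℝ (Fin d))) (E : ℕ → Set (EuclideanSpace ℝ (Fin d))) : Prop where
  cover : ⋃ r, E r = R
  disjoint_interior : ∀ r s, r ≠ s → Disjoint (interior (E r)) (interior (E s))
  face_to_face : ∃ 𝒯 : ℕ → Set (Set (EuclideanSpace ℝ (Fin d))),
    (∀ r, IsSubdivision A (E r) (𝒯 r)) ∧ IsSubdivision A R (⋃ r, 𝒯 r)

/-- The tiles `ℰ^(r)(Q)`: tiles `Π_{I,B}` of `P` with `|I| = r`, `B ∩ Q = ∅` and `I ⊆ Q`. -/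
def linkTiles (P : Set (Finset (Fin n) × Finset (Fin n))) (Q : Finset (Fin n)) (r : ℕ) :
    Set (Finset (Fin n) × Finset (Fin n)) :=
  {t ∈ P | t.1.card = r ∧ Disjoint t.2 Q ∧ t.1 ⊆ Q}

/-- The set of simplices `𝒯^(r)(Q) = {ch({a_b}_{b ∈ B}) : Π_{I,B} ∈ ℰ^(r)(Q)}`. -/
def linkSimplices (a : Fin n → EuclideanSpace ℝ (Fin d))
    (P : Set (Finset (Fin n) × Finset (Fin n))) (Q : Finset (Fin n)) (r : ℕ) :
    Set (Set (EuclideanSpace ℝ (Fin d))) :=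
  {Δ | ∃ t ∈ linkTiles P Q r, Δ = convexHull ℝ (a '' (t.2 : Set (Fin n)))}

/-- The region `E^(r)(Q)`, the union of the simplices `ch({a_b}_{b ∈ B})`, `Π_{I,B} ∈ ℰ^(r)(Q)`. -/
def regionE (a : Fin n → EuclideanSpace ℝ (Fin d))
    (P : Set (Finset (Fin n) × Finset (Fin n))) (Q : Finset (Fin n)) (r : ℕ) :
    Set (EuclideanSpace ℝ (Fin d)) :=
  ⋃ t ∈ linkTiles P Q r, convexHull ℝ (a '' (t.2 : Set (Fin n)))

/-- The link region `R(Q) = E^(k)(Q)`, `k = |Q|`. -/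
def linkRegion (a : Fin n → EuclideanSpace ℝ (Fin d))
    (P : Set (Finset (Fin n) × Finset (Fin n))) (Q : Finset (Fin n)) :
    Set (EuclideanSpace ℝ (Fin d)) :=
  regionE a P Q Q.card

/-- The points `{a_i}_{i ∉ Q}`. -/
def pointsOff (a : Fin n → EuclideanSpace ℝ (Fin d)) (Q : Finset (Fin n)) :
    Set (EuclideanSpace ℝ (Fin d)) :=
  a '' {i | i ∉ Q}

/-- `ch_Q(A) = ch({a_i}_{i ∉ Q})`. -/
def chQ (a : Fin n → EuclideanSpace ℝ (Fin d)) (Q : Finset (Fin n)) :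
    Set (EuclideanSpace ℝ (Fin d)) :=
  convexHull ℝ (pointsOff a Q)

end LinkTiling

end

/-!
Coefficient vectors turn a fine tiling of `Z(V)` into a union of faces of the cube `[0, 1]^n` that
the projection `γ ↦ ∑ i, γ i • v i` maps bijectively onto `Z(V)`. Setting the coordinate `q` to zero
produces such a union of faces for the vectors other than `v q`: along the path of coefficient
vectors over a segment of direction `v q`, the coordinate `q` never grows faster than the segment is
traversed, and if it gains the full length of the segment, then the path moves in direction `q`
only. Once all of `Q` is deleted in this way, the tiles `Π_{I,B}` with `I ⊆ Q` are the ones that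
contain the origin, where they are cones over the vectors `v b`, `b ∈ B \ Q`. Slicing these cones at
a small positive height gives the simplices of the triangulation, together with the
lower-dimensional simplices of the tiles with `B ∩ Q ≠ ∅`, which do not contribute to the covered
region.
-/

namespace LinkTiling

open Set Filter Topology Function
open Fintype (linearCombination)

section RealPaths

theorem antitoneOn_Icc_of_eventually_le {g : ℝ → ℝ} {a b : ℝ} (hg : ContinuousOn g (Icc a b))
    (h : ∀ x ∈ Ico a b, ∀ᶠ z in 𝓝[>] x, g z ≤ g x) : AntitoneOn g (Icc a b) := by
  intro x hx y hy hxy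
  have hsub : Icc x y ⊆ Icc a b := Icc_subset_Icc hx.1 hy.2
  refine image_le_of_liminf_slope_right_le_deriv_boundary (B := fun _ => g x) (B' := fun _ => 0)
    (hg.mono hsub) le_rfl continuousOn_const (fun _ _ => hasDerivWithinAt_const ..)
    (fun u hu r hr => Eventually.frequently ?_) (right_mem_Icc.mpr hxy)
  filter_upwards [h u (Ico_subset_Ico hx.1 hy.2 hu), self_mem_nhdsWithin] with z hz huz
  refine lt_of_le_of_lt ?_ hr
  rw [slope_def_field]
  exact div_nonpos_of_nonpos_of_nonneg (sub_nonpos.mpr hz) (sub_nonneg.mpr (le_of_lt huz))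

theorem eq_left_of_eventually_eq {E : Type*} [NormedAddCommGroup E] [NormedSpace ℝ E] {f : ℝ → E}
    {a b : ℝ} (hf : ContinuousOn f (Icc a b))
    (h : ∀ x ∈ Ico a b, ∀ᶠ z in 𝓝[>] x, f z = f x) : ∀ x ∈ Icc a b, f x = f a := by
  refine constant_of_has_deriv_right_zero hf fun x hx => ?_
  rw [← hasDerivWithinAt_Ioi_iff_Ici]
  exact (hasDerivWithinAt_const x _ (f x)).congr_of_eventuallyEq (h x hx) rfl

theorem continuousOn_invFunOn_image {X Y : Type*} [TopologicalSpace X] [TopologicalSpace Y]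
    [T2Space Y] [Nonempty X] {f : X → Y} {K : Set X} (hK : IsCompact K) (hf : ContinuousOn f K)
    (hinj : InjOn f K) : ContinuousOn (invFunOn f K) (f '' K) := by
  refine continuousOn_iff_isClosed.mpr fun C hC => ⟨f '' (K ∩ C),
    ((hK.inter_right hC).image_of_continuousOn (hf.mono inter_subset_left)).isClosed, ?_⟩
  ext y
  constructor
  · rintro ⟨hy, x, hx, rfl⟩
    rw [mem_preimage, hinj.leftInvOn_invFunOn hx] at hy
    exact ⟨⟨x, ⟨hx, hy⟩, rfl⟩, x, hx, rfl⟩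
  · rintro ⟨⟨x, hx, rfl⟩, -⟩
    refine ⟨?_, x, hx.1, rfl⟩
    rw [mem_preimage, hinj.leftInvOn_invFunOn hx.1]
    exact hx.2

end RealPaths

section ConvexHull

variable {E : Type*}

theorem convexHull_inter_setOf_eq [AddCommGroup E] [Module ℝ E] {s : Set E} {l : E →ₗ[ℝ] ℝ} {c : ℝ}
    (hs : ∀ x ∈ s, l x ≤ c) :
    convexHull ℝ s ∩ {x | l x = c} = convexHull ℝ {x ∈ s | l x = c} := by
  refine Subset.antisymm ?_ (subset_inter (convexHull_mono (sep_subset _ _))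
    (convexHull_min (fun x hx => hx.2) (convex_hyperplane l.isLinear c)))
  let K : Set E := {x | l x ≤ c ∧ (l x = c → x ∈ convexHull ℝ {x ∈ s | l x = c})}
  have hK : Convex ℝ K := by
    refine convex_iff_forall_pos.mpr fun x hx y hy a b ha hb hab => ?_
    have hval : l (a • x + b • y) = c + a * (l x - c) + b * (l y - c) := by
      rw [map_add, map_smul, map_smul, smul_eq_mul, smul_eq_mul]
      linear_combination c * hab
    have hxc := mul_nonpos_of_nonneg_of_nonpos ha.le (sub_nonpos.mpr hx.1)
    have hyc := mul_nonpos_of_nonneg_of_nonpos hb.le (sub_nonpos.mpr hy.1)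
    refine ⟨by linarith, fun heq => ?_⟩
    have hlx : l x = c := by
      have : a * (l x - c) = 0 := by linarith
      exact sub_eq_zero.mp ((mul_eq_zero.mp this).resolve_left ha.ne')
    have hly : l y = c := by
      have : b * (l y - c) = 0 := by linarith
      exact sub_eq_zero.mp ((mul_eq_zero.mp this).resolve_left hb.ne')
    exact convex_convexHull ℝ _ (hx.2 hlx) (hy.2 hly) ha.le hb.le hab
  have hsK : convexHull ℝ s ⊆ K := convexHull_min
    (fun x hx => ⟨hs x hx, fun hlx => subset_convexHull ℝ _ ⟨hx, hlx⟩⟩) hK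
  exact fun x hx => (hsK hx.1).2 hx.2

theorem isExposed_convexHull_sep [AddCommGroup E] [Module ℝ E] [TopologicalSpace E]
    {s : Set E} (l : StrongDual ℝ E) {c : ℝ} (hs : ∀ x ∈ s, l x ≤ c) :
    IsExposed ℝ (convexHull ℝ s) (convexHull ℝ {x ∈ s | l x = c}) := by
  intro hne
  have hinter : convexHull ℝ s ∩ {x | l x = c} = convexHull ℝ {x ∈ s | l x = c} :=
    convexHull_inter_setOf_eq (l := l.toLinearMap) hs
  have hle : ∀ x ∈ convexHull ℝ s, l x ≤ c :=
    convexHull_min hs (convex_halfSpace_le l.isLinear c)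
  obtain ⟨x₀, hx₀⟩ := hne
  rw [← hinter] at hx₀ ⊢
  refine ⟨l, Subset.antisymm (fun x hx => ⟨hx.1, fun y hy => (hle y hy).trans_eq hx.2.symm⟩)
    fun x hx => ⟨hx.1, (hle x hx.1).antisymm ?_⟩⟩
  exact hx₀.2.symm.trans_le (hx.2 x₀ hx₀.1)

theorem affineSpan_image_ne_top [AddCommGroup E] [Module ℝ E] {ι : Type*} (p : ι → E)
    {C : Finset ι} (hC : C.card ≤ Module.finrank ℝ E) : affineSpan ℝ (p '' C) ≠ ⊤ := by
  classical
  intro htop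
  rcases C.eq_empty_or_nonempty with rfl | hne
  · simp at htop
  · obtain ⟨m, hm⟩ := Nat.exists_eq_add_one_of_ne_zero hne.card_pos.ne'
    have hle := finrank_vectorSpan_image_finset_le ℝ p C hm
    rw [Finset.coe_image, ← direction_affineSpan, htop, AffineSubspace.direction_top,
      finrank_top] at hle
    omega

theorem subset_of_convex_of_subset_union [AddCommGroup E] [Module ℝ E] [TopologicalSpace E]
    [IsTopologicalAddGroup E] [ContinuousSMul ℝ E] {K R N : Set E} (hK : Convex ℝ K)
    (hKint : (interior K).Nonempty) (hR : IsClosed R) (hN : interior N = ∅) (h : K ⊆ R ∪ N) :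
    K ⊆ R := by
  have hdense : interior K ⊆ R := sdiff_eq_empty.mp <| subset_empty_iff.mp <| hN ▸
    interior_maximal (sdiff_subset_iff.mpr (interior_subset.trans h)) (isOpen_interior.sdiff hR)
  calc K ⊆ closure K := subset_closure
    _ = closure (interior K) := (hK.closure_interior_eq_closure_of_nonempty_interior hKint).symm
    _ ⊆ R := closure_minimal hdense hR

variable [NormedAddCommGroup E] [NormedSpace ℝ E] [FiniteDimensional ℝ E]

theorem exists_strongDual_apply_sub_eq {ι : Type*} {p : ι → E} (hp : AffineIndependent ℝ p)
    (f : ι → ℝ) : ∃ l : StrongDual ℝ E, ∀ i j, l (p i) - l (p j) = f i - f j := by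
  rcases isEmpty_or_nonempty ι with _ | ⟨⟨k⟩⟩
  · exact ⟨0, isEmptyElim⟩
  have hli := (affineIndependent_iff_linearIndependent_vsub ℝ p k).mp hp
  obtain ⟨g, hg⟩ :=
    ((Module.Basis.span hli).constr ℝ fun i : {x // x ≠ k} => f i - f k).exists_extend
  have hgk : ∀ i, g (p i) - g (p k) = f i - f k := by
    intro i
    rcases eq_or_ne i k with rfl | hi
    · simp
    · have := LinearMap.congr_fun hg (Module.Basis.span hli ⟨i, hi⟩)
      rw [Module.Basis.constr_basis] at this
      simpa [Module.Basis.span_apply] using this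
  refine ⟨g.toContinuousLinearMap, fun i j => ?_⟩
  simp only [LinearMap.coe_toContinuousLinearMap']
  linear_combination hgk i - hgk j

theorem isExposed_convexHull_image_of_affineIndependent {ι : Type*} {p : ι → E} {B C : Set ι}
    (hB : AffineIndependent ℝ (fun b : B => p b)) (hC : C ⊆ B) :
    IsExposed ℝ (convexHull ℝ (p '' B)) (convexHull ℝ (p '' C)) := by
  rcases C.eq_empty_or_nonempty with rfl | ⟨c, hc⟩
  · simpa using isExposed_empty
  obtain ⟨l, hl⟩ := exists_strongDual_apply_sub_eq hB ((((↑) : B → ι) ⁻¹' C).indicator 1)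
  have hlc : ∀ b ∈ B, l (p b) ≤ l (p c) ∧ (l (p b) = l (p c) ↔ b ∈ C) := by
    intro b hb
    have hbc : l (p b) - l (p c) = _ - _ := hl ⟨b, hb⟩ ⟨c, hC hc⟩
    rw [indicator_of_mem (a := (⟨c, hC hc⟩ : B)) hc, Pi.one_apply] at hbc
    by_cases hbC : b ∈ C
    · rw [indicator_of_mem (a := (⟨b, hb⟩ : B)) hbC, Pi.one_apply, sub_self, sub_eq_zero] at hbc
      exact ⟨hbc.le, iff_of_true hbc hbC⟩
    · rw [indicator_of_notMem (a := (⟨b, hb⟩ : B)) hbC] at hbc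
      exact ⟨by linarith, iff_of_false (by linarith) hbC⟩
  have himage : p '' C = {x ∈ p '' B | l x = l (p c)} := by
    ext x
    constructor
    · rintro ⟨b, hb, rfl⟩
      exact ⟨mem_image_of_mem p (hC hb), (hlc b (hC hb)).2.mpr hb⟩
    · rintro ⟨⟨b, hb, rfl⟩, hx⟩
      exact mem_image_of_mem p ((hlc b hb).2.mp hx)
  rw [himage]
  exact isExposed_convexHull_sep l (forall_mem_image.mpr fun b hb => (hlc b hb).1)

theorem interior_biUnion_convexHull_eq_empty {κ : Type*} {F : Set κ} (hF : F.Countable)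
    {s : κ → Set E} (hs : ∀ k ∈ F, affineSpan ℝ (s k) ≠ ⊤) :
    interior (⋃ k ∈ F, convexHull ℝ (s k)) = ∅ := by
  borelize E
  refine MeasureTheory.Measure.interior_eq_empty_of_null
    (μ := MeasureTheory.Measure.addHaar)
    ((MeasureTheory.measure_biUnion_null_iff hF).mpr fun k hk => ?_)
  exact MeasureTheory.measure_mono_null (convexHull_subset_affineSpan _)
    (MeasureTheory.Measure.addHaar_affineSubspace _ _ (hs k hk))

end ConvexHull

section Cubes

variable {ι : Type*} {I B J C : Finset ι} {T : Set (Finset ι × Finset ι)} {γ δ : ι → ℝ}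

/-- The face of the unit cube `[0, 1]^ι` whose points have the coefficients that parametrize the
tile `Π_{I,B}`: arbitrary on `B`, equal to `1` on the rest of `I`, and equal to `0` elsewhere. -/
def cube (I B : Finset ι) : Set (ι → ℝ) :=
  Icc ((I \ B : Set ι).indicator 1) ((I ∪ B : Set ι).indicator 1)

theorem mem_cube : γ ∈ cube I B ↔
    ∀ i, γ i ∈ Icc 0 1 ∧ (i ∉ B → (i ∈ I → γ i = 1) ∧ (i ∉ I → γ i = 0)) := by
  simp only [cube, mem_Icc, Pi.le_def, ← forall_and]
  refine forall_congr' fun i => ?_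
  by_cases hB : i ∈ B <;> by_cases hI : i ∈ I <;>
    simp [hB, hI, le_antisymm_iff] <;> grind

theorem apply_eq_of_mem_cube (hγ : γ ∈ cube I B) (hδ : δ ∈ cube I B) {i : ι} (hi : i ∉ B) :
    γ i = δ i := by
  have hγi := (mem_cube.mp hγ i).2 hi
  have hδi := (mem_cube.mp hδ i).2 hi
  by_cases hI : i ∈ I
  · rw [hγi.1 hI, hδi.1 hI]
  · rw [hγi.2 hI, hδi.2 hI]

theorem mem_of_apply_mem_Ioo (hγ : γ ∈ cube I B) {i : ι} (hi : γ i ∈ Ioo 0 1) : i ∈ B := by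
  by_contra hB
  have hγi := (mem_cube.mp hγ i).2 hB
  by_cases hI : i ∈ I
  · exact hi.2.ne (hγi.1 hI)
  · exact hi.1.ne' (hγi.2 hI)

theorem convex_cube (I B : Finset ι) : Convex ℝ (cube I B) := convex_Icc _ _

theorem isCompact_cube (I B : Finset ι) : IsCompact (cube I B) := isCompact_Icc

theorem cube_subset_cube (hlower : (I \ B : Set ι) ⊆ J \ C) (hupper : (J ∪ C : Set ι) ⊆ I ∪ B) :
    cube J C ⊆ cube I B :=
  Icc_subset_Icc (indicator_le_indicator_of_subset hlower fun _ => zero_le_one)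
    (indicator_le_indicator_of_subset hupper fun _ => zero_le_one)

/-- The union of the coefficient cubes of a family of pairs of index sets. -/
def cubes (T : Set (Finset ι × Finset ι)) : Set (ι → ℝ) := ⋃ t ∈ T, cube t.1 t.2

theorem mem_cubes : γ ∈ cubes T ↔ ∃ t ∈ T, γ ∈ cube t.1 t.2 := by
  simp only [cubes, mem_iUnion, exists_prop]

theorem isCompact_cubes [Finite ι] (T : Set (Finset ι × Finset ι)) : IsCompact (cubes T) :=
  (Set.toFinite T).isCompact_biUnion fun t _ => isCompact_cube t.1 t.2

theorem eventually_mem_cube_imp [Finite ι] (γ : ι → ℝ) :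
    ∀ᶠ δ in 𝓝 γ, ∀ t : Finset ι × Finset ι, δ ∈ cube t.1 t.2 → γ ∈ cube t.1 t.2 :=
  (locallyFinite_of_finite fun t : Finset ι × Finset ι => cube t.1 t.2).eventually_subset
    (fun t => (isCompact_cube t.1 t.2).isClosed) γ

end Cubes

section Deletion

variable {ι : Type*} [DecidableEq ι]

/-- The pairs of index sets that remain when the vectors indexed by `Q` are deleted, that is, when
the coefficients with index in `Q` are set to zero. -/
def deletion (T : Set (Finset ι × Finset ι)) (Q : Finset ι) : Set (Finset ι × Finset ι) :=
  (fun t => (t.1 \ Q, t.2 \ Q)) '' T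

theorem deletion_empty (T : Set (Finset ι × Finset ι)) : deletion T ∅ = T := by
  simp [deletion]

theorem deletion_deletion (T : Set (Finset ι × Finset ι)) (Q R : Finset ι) :
    deletion (deletion T Q) R = deletion T (Q ∪ R) := by
  simp only [deletion, image_image, Finset.sdiff_sdiff_left']
  simp [Finset.sdiff_union_distrib]

theorem image_update_zero_cube (I B : Finset ι) (q : ι) :
    (fun γ => update γ q 0) '' cube I B = cube (I \ {q}) (B \ {q}) := by
  ext γ
  constructor
  · rintro ⟨δ, hδ, rfl⟩
    refine mem_cube.mpr fun i => ?_
    rcases eq_or_ne i q with rfl | hi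
    · simp
    · simpa [hi] using mem_cube.mp hδ i
  · intro hγ
    have hγq : γ q = 0 := ((mem_cube.mp hγ q).2 (by simp)).2 (by simp)
    refine ⟨update γ q (if q ∈ I then 1 else 0), mem_cube.mpr fun i => ?_, ?_⟩
    · rcases eq_or_ne i q with rfl | hi
      · by_cases hI : i ∈ I <;> simp [hI]
      · simpa [hi] using mem_cube.mp hγ i
    · simp [← hγq]

theorem cubes_deletion_singleton (T : Set (Finset ι × Finset ι)) (q : ι) :
    cubes (deletion T {q}) = (fun γ => update γ q 0) '' cubes T := by
  simp only [cubes, deletion, biUnion_image, image_iUnion₂, image_update_zero_cube]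

end Deletion

section ZonotopeSection

variable {ι W : Type*} [Fintype ι] [AddCommGroup W] [Module ℝ W] {v : ι → W}
  {S : Finset ι} {T : Set (Finset ι × Finset ι)} {γ δ : ι → ℝ} {q : ι}

theorem eq_of_linearCombination_eq {B : Finset ι} (hB : LinearIndepOn ℝ v (B : Set ι))
    (hout : ∀ i ∉ B, γ i = δ i) (h : linearCombination ℝ v γ = linearCombination ℝ v δ) :
    γ = δ := by
  have hsupp : ∀ i ∉ B, (γ - δ) i = 0 := fun i hi => sub_eq_zero.mpr (hout i hi)
  have hsum : ∑ i ∈ B, (γ - δ) i • v i = 0 := by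
    rw [Finset.sum_subset (Finset.subset_univ B) fun i _ hi => by rw [hsupp i hi, zero_smul],
      ← Fintype.linearCombination_apply, map_sub, h, sub_self]
  refine sub_eq_zero.mp (funext fun i => ?_)
  by_cases hi : i ∈ B
  · exact linearIndepOn_finset_iff.mp hB _ hsum i hi
  · exact hsupp i hi

theorem linearCombination_update_zero [DecidableEq ι] (v : ι → W) (γ : ι → ℝ) (q : ι) :
    linearCombination ℝ v (update γ q 0) = linearCombination ℝ v γ - γ q • v q := by
  have hγ : update γ q 0 = γ - Pi.single q (γ q) := by
    ext i
    rcases eq_or_ne i q with rfl | hi <;> simp [*]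
  rw [hγ, map_sub, Fintype.linearCombination_apply_single]

/-- The cubes of `T` form a section of the projection `γ ↦ ∑ i, γ i • v i` of the cube `[0, 1]^S`
onto the zonotope of `(v i)_{i ∈ S}`. This is how a fine zonotopal tiling is seen on the level of
coefficients, except that the tiles are not required to be full-dimensional, which makes the notion
stable under deletion of vectors. -/
structure IsZonotopeSection (v : ι → W) (S : Finset ι) (T : Set (Finset ι × Finset ι)) :
    Prop where
  linearIndepOn : ∀ t ∈ T, LinearIndepOn ℝ v (t.2 : Set ι)
  subset : ∀ t ∈ T, t.1 ⊆ S ∧ t.2 ⊆ S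
  surjOn : SurjOn (linearCombination ℝ v) (cubes T) (linearCombination ℝ v '' cube ∅ S)
  injOn : InjOn (linearCombination ℝ v) (cubes T)

namespace IsZonotopeSection

theorem cubes_subset (h : IsZonotopeSection v S T) : cubes T ⊆ cube ∅ S :=
  iUnion₂_subset fun t ht => cube_subset_cube (by simp) <| by
    simpa using h.subset t ht

section Path

variable [DecidableEq ι]

theorem eq_add_single_or_apply_eq (h : IsZonotopeSection v S T) {t : Finset ι × Finset ι}
    (ht : t ∈ T) (hγ : γ ∈ cube t.1 t.2) (hδ : δ ∈ cube t.1 t.2) {s : ℝ}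
    (hL : linearCombination ℝ v δ = linearCombination ℝ v γ + s • v q) :
    δ = γ + Pi.single q s ∨ δ q = γ q := by
  by_cases hq : q ∈ t.2
  · refine Or.inl (eq_of_linearCombination_eq (h.linearIndepOn t ht) (fun i hi => ?_) ?_)
    · have hiq : i ≠ q := by rintro rfl; exact hi hq
      rw [Pi.add_apply, Pi.single_eq_of_ne hiq, add_zero, apply_eq_of_mem_cube hδ hγ hi]
    · rw [map_add, Fintype.linearCombination_apply_single, hL]
  · exact Or.inr (apply_eq_of_mem_cube hδ hγ hq)

theorem eventually_eq_add_single_or_apply_eq (h : IsZonotopeSection v S T)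
    {p : ℝ → ι → ℝ} {c : ℝ} (hp : ContinuousOn p (Icc 0 1)) (hmem : ∀ t ∈ Icc 0 1, p t ∈ cubes T)
    (hL : ∀ t ∈ Icc 0 1,
      linearCombination ℝ v (p t) = linearCombination ℝ v (p 0) + (t * c) • v q)
    {x : ℝ} (hx : x ∈ Ico 0 1) : ∀ᶠ z in 𝓝[>] x, z ∈ Icc 0 1 ∧ x < z ∧
      (p z = p x + Pi.single q ((z - x) * c) ∨ p z q = p x q) := by
  have hxI := Ico_subset_Icc_self hx
  have hpx : Tendsto p (𝓝[>] x) (𝓝 (p x)) := (hp x hxI).mono_left <|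
    nhdsWithin_le_of_mem (Icc_mem_nhdsGT_of_mem hx)
  filter_upwards [hpx.eventually (eventually_mem_cube_imp (p x)), self_mem_nhdsWithin,
    Icc_mem_nhdsGT_of_mem hx] with z hz hxz hzI
  obtain ⟨t, ht, hzt⟩ := mem_cubes.mp (hmem z hzI)
  refine ⟨hzI, hxz, h.eq_add_single_or_apply_eq ht (hz t hzt) hzt ?_⟩
  rw [hL z hzI, hL x hxI]
  module

theorem path_eq_add_single (h : IsZonotopeSection v S T) {p : ℝ → ι → ℝ} {c : ℝ} (hc : 0 ≤ c)
    (hp : ContinuousOn p (Icc 0 1)) (hmem : ∀ t ∈ Icc 0 1, p t ∈ cubes T)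
    (hL : ∀ t ∈ Icc 0 1,
      linearCombination ℝ v (p t) = linearCombination ℝ v (p 0) + (t * c) • v q)
    (hq : p 1 q = p 0 q + c) : ∀ t ∈ Icc 0 1, p t = p 0 + Pi.single q (t * c) := by
  have hanti : AntitoneOn (fun t => p t q - t * c) (Icc 0 1) := by
    refine antitoneOn_Icc_of_eventually_le (by fun_prop) fun x hx => ?_
    filter_upwards [h.eventually_eq_add_single_or_apply_eq hp hmem hL hx] with z ⟨_, hxz, hz⟩
    have : 0 ≤ (z - x) * c := mul_nonneg (sub_nonneg.mpr hxz.le) hc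
    rcases hz with hz | hz
    · simp only [hz, Pi.add_apply, Pi.single_eq_same]
      linarith
    · linarith
  have hconst : ∀ t ∈ Icc (0 : ℝ) 1, p t q = p 0 q + t * c := by
    intro t ht
    have hle := hanti (left_mem_Icc.mpr zero_le_one) ht ht.1
    have hge := hanti ht (right_mem_Icc.mpr zero_le_one) ht.2
    simp only [hq] at hle hge
    linarith
  have hlocal : ∀ x ∈ Ico (0 : ℝ) 1, ∀ᶠ z in 𝓝[>] x,
      p z - Pi.single q (z * c) = p x - Pi.single q (x * c) := by
    intro x hx
    have hxI := Ico_subset_Icc_self hx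
    filter_upwards [h.eventually_eq_add_single_or_apply_eq hp hmem hL hx] with z ⟨hzI, _, hz⟩
    rcases hz with hz | hz
    · rw [hz, sub_mul, Pi.single_sub]
      abel
    · have hzx : z * c = x * c := by
        rw [hconst z hzI, hconst x hxI] at hz
        linarith
      rw [hzx, h.injOn (hmem z hzI) (hmem x hxI) (by rw [hL z hzI, hL x hxI, hzx])]
  intro t ht
  have hm := eq_left_of_eventually_eq (f := fun t => p t - Pi.single q (t * c))
    (hp.sub ((continuous_single (A := fun _ : ι => ℝ) q).comp (by fun_prop)).continuousOn)
    hlocal t ht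
  simpa [sub_eq_iff_eq_add] using hm

end Path

variable [TopologicalSpace W] [IsTopologicalAddGroup W] [ContinuousSMul ℝ W] [T2Space W]

theorem exists_path (h : IsZonotopeSection v S T) {x y : W}
    (hx : x ∈ linearCombination ℝ v '' cube ∅ S) (hy : y ∈ linearCombination ℝ v '' cube ∅ S) :
    ∃ p : ℝ → ι → ℝ, ContinuousOn p (Icc 0 1) ∧ ∀ t ∈ Icc 0 1,
      p t ∈ cubes T ∧ linearCombination ℝ v (p t) = AffineMap.lineMap x y t := by
  have hmem : MapsTo (AffineMap.lineMap x y) (Icc (0 : ℝ) 1)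
      (linearCombination ℝ v '' cubes T) := fun t ht =>
    h.surjOn (((convex_cube ∅ S).linear_image _).lineMap_mem hx hy ht)
  have hcont : ContinuousOn (invFunOn (linearCombination ℝ v) (cubes T))
      (linearCombination ℝ v '' cubes T) :=
    continuousOn_invFunOn_image (isCompact_cubes T)
      (LinearMap.continuous_of_finiteDimensional _).continuousOn h.injOn
  exact ⟨_, hcont.comp AffineMap.lineMap_continuous.continuousOn hmem, fun t ht =>
    ⟨invFunOn_mem (hmem ht), invFunOn_eq (hmem ht)⟩⟩

variable [DecidableEq ι]

/-- The hypothesis `hL` says that `γ` and `δ` have the same image once their coordinate `q` is set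
to zero. -/
theorem eq_add_single_and_segment_subset (h : IsZonotopeSection v S T) (hγ : γ ∈ cubes T)
    (hδ : δ ∈ cubes T)
    (hL : linearCombination ℝ v δ = linearCombination ℝ v γ + (δ q - γ q) • v q) :
    δ = γ + Pi.single q (δ q - γ q) ∧ segment ℝ γ δ ⊆ cubes T := by
  wlog hle : γ q ≤ δ q generalizing γ δ
  · obtain ⟨heq, hseg⟩ := this hδ hγ (by rw [hL]; module) (le_of_not_ge hle)
    refine ⟨?_, segment_symm ℝ γ δ ▸ hseg⟩
    conv_rhs => rw [heq]
    rw [add_assoc, ← Pi.single_add]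
    simp
  obtain ⟨p, hp, hpL⟩ := h.exists_path (mem_image_of_mem _ (h.cubes_subset hγ))
    (mem_image_of_mem _ (h.cubes_subset hδ))
  have hp0 : p 0 = γ := h.injOn (hpL 0 (by simp)).1 hγ (by simp [(hpL 0 (by simp)).2])
  have hp1 : p 1 = δ := h.injOn (hpL 1 (by simp)).1 hδ (by simp [(hpL 1 (by simp)).2])
  have hpath := h.path_eq_add_single (sub_nonneg.mpr hle) hp (fun t ht => (hpL t ht).1)
    (fun t ht => by
      rw [(hpL t ht).2, hp0, hL, AffineMap.lineMap_apply_module']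
      module) (by rw [hp0, hp1]; ring)
  have hδγ : δ = γ + Pi.single q (δ q - γ q) := by
    simpa [hp0, hp1] using hpath 1 (by simp)
  refine ⟨hδγ, ?_⟩
  rw [segment_eq_image_lineMap]
  rintro _ ⟨t, ht, rfl⟩
  convert (hpL t ht).1 using 1
  rw [hpath t ht, hp0, AffineMap.lineMap_apply_module', sub_eq_iff_eq_add'.mpr hδγ,
    ← Pi.single_smul, smul_eq_mul, add_comm]

theorem surjOn_cubes_deletion_singleton (h : IsZonotopeSection v S T) (hq : q ∈ S) :
    SurjOn (linearCombination ℝ v) (cubes (deletion T {q}))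
      (linearCombination ℝ v '' cube ∅ (S \ {q})) := by
  rintro _ ⟨β, hβ, rfl⟩
  rw [cubes_deletion_singleton, image_image]
  have hβq : β q = 0 := ((mem_cube.mp hβ q).2 (by simp)).2 (by simp)
  have hβS : β ∈ cube ∅ S := cube_subset_cube (by simp) (by simp) hβ
  have hβS' : β + Pi.single q 1 ∈ cube ∅ S := by
    refine mem_cube.mpr fun i => ?_
    rcases eq_or_ne i q with rfl | hi
    · simp [hβq, hq]
    · simpa [hi] using mem_cube.mp hβS i
  obtain ⟨p, hp, hpL⟩ := h.exists_path (mem_image_of_mem _ hβS) (mem_image_of_mem _ hβS')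
  have hbound : ∀ t ∈ Icc (0 : ℝ) 1, p t q ∈ Icc 0 1 := fun t ht =>
    (mem_cube.mp (h.cubes_subset (hpL t ht).1) q).1
  have hzero : 0 ∈ Icc (p 1 q - 1) (p 0 q - 0) :=
    ⟨by linarith [(hbound 1 (by simp)).2], by linarith [(hbound 0 (by simp)).1]⟩
  obtain ⟨t, ht, htq : p t q - t = 0⟩ :=
    intermediate_value_Icc' (f := fun t => p t q - t) zero_le_one (by fun_prop) hzero
  refine ⟨p t, (hpL t ht).1, ?_⟩
  beta_reduce
  rw [linearCombination_update_zero, (hpL t ht).2, sub_eq_zero.mp htq, map_add,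
    Fintype.linearCombination_apply_single, AffineMap.lineMap_apply_module']
  module

theorem injOn_cubes_deletion_singleton (h : IsZonotopeSection v S T) :
    InjOn (linearCombination ℝ v) (cubes (deletion T {q})) := by
  rw [cubes_deletion_singleton]
  rintro _ ⟨γ, hγ, rfl⟩ _ ⟨δ, hδ, rfl⟩ hL
  simp only [linearCombination_update_zero] at hL
  obtain ⟨hδγ, -⟩ := h.eq_add_single_and_segment_subset (q := q) hγ hδ <| by
    rw [sub_eq_iff_eq_add.mp hL.symm]
    module
  ext i
  rcases eq_or_ne i q with rfl | hi
  · simp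
  · simp only [congrFun hδγ i, update_of_ne hi, Pi.add_apply, Pi.single_eq_of_ne hi, add_zero]

theorem deletion_singleton (h : IsZonotopeSection v S T) (hq : q ∈ S) :
    IsZonotopeSection v (S \ {q}) (deletion T {q}) where
  linearIndepOn := forall_mem_image.mpr fun t ht =>
    (h.linearIndepOn t ht).mono (by simp)
  subset := forall_mem_image.mpr fun t ht =>
    ⟨Finset.sdiff_subset_sdiff (h.subset t ht).1 le_rfl,
      Finset.sdiff_subset_sdiff (h.subset t ht).2 le_rfl⟩
  surjOn := h.surjOn_cubes_deletion_singleton hq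
  injOn := h.injOn_cubes_deletion_singleton

theorem deletion {Q : Finset ι} (h : IsZonotopeSection v S T) (hQ : Q ⊆ S) :
    IsZonotopeSection v (S \ Q) (deletion T Q) := by
  induction Q using Finset.induction_on with
  | empty => simpa [deletion_empty] using h
  | insert q Q hq ih =>
    obtain ⟨hqS, hQS⟩ := Finset.insert_subset_iff.mp hQ
    have := (ih hQS).deletion_singleton (Finset.mem_sdiff.mpr ⟨hqS, hq⟩)
    rwa [deletion_deletion, sdiff_sdiff_left, Finset.sup_eq_union, Finset.union_comm,
      ← Finset.insert_eq] at this

theorem eq_of_sdiff_singleton_eq {I I' B : Finset ι} (h : IsZonotopeSection v S T)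
    (hcard : ∀ t ∈ T, t.2.card ≤ B.card) (hI : (I, B) ∈ T) (hI' : (I', B) ∈ T) (hq : q ∉ B)
    (heq : I \ {q} = I' \ {q}) : I = I' := by
  by_contra hne
  let center (J : Finset ι) : ι → ℝ := fun i => if i ∈ B then 1 / 2 else if i ∈ J then 1 else 0
  have hcenter : ∀ J, (J, B) ∈ T → center J ∈ cubes T := fun J hJ =>
    mem_cubes.mpr ⟨_, hJ, mem_cube.mpr fun i => by
      by_cases hB : i ∈ B <;> by_cases hJ : i ∈ J <;> norm_num [center, hB, hJ]⟩
  have hoff : ∀ i ≠ q, i ∈ I ↔ i ∈ I' := fun i hi => by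
    simpa [hi] using Finset.ext_iff.mp heq i
  have hon : ¬(q ∈ I ↔ q ∈ I') := fun hiff => hne <| by
    ext i
    rcases eq_or_ne i q with rfl | hi
    exacts [hiff, hoff i hi]
  have hcenterI' : center I' = center I + Pi.single q (center I' q - center I q) := by
    ext i
    rcases eq_or_ne i q with rfl | hi
    · simp
    · simp [center, hi, hoff i hi]
  have hsegment := (h.eq_add_single_and_segment_subset (hcenter I hI) (hcenter I' hI') (by
    conv_lhs => rw [hcenterI', map_add, Fintype.linearCombination_apply_single])).2
  obtain ⟨t, ht, hmem⟩ := mem_cubes.mp (hsegment (midpoint_mem_segment _ _))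
  have hsub : insert q B ⊆ t.2 := by
    intro i hi
    refine mem_of_apply_mem_Ioo hmem ?_
    rcases Finset.mem_insert.mp hi with rfl | hB
    · rw [pi_midpoint_apply, midpoint_eq_smul_add]
      by_cases hI : i ∈ I <;> by_cases hI' : i ∈ I' <;> simp_all [center] <;> norm_num
    · rw [pi_midpoint_apply, midpoint_eq_smul_add]
      norm_num [center, hB]
  have hle : (insert q B).card ≤ B.card := (Finset.card_le_card hsub).trans (hcard t ht)
  rw [Finset.card_insert_of_notMem hq] at hle
  exact absurd hle (Nat.not_succ_le_self _)

theorem eq_of_sdiff_eq {I I' B Q : Finset ι} (h : IsZonotopeSection v S T) (hQ : Q ⊆ S)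
    (hcard : ∀ t ∈ T, t.2.card ≤ B.card) (hI : (I, B) ∈ T) (hI' : (I', B) ∈ T)
    (hdisj : Disjoint B Q) (heq : I \ Q = I' \ Q) : I = I' := by
  induction Q using Finset.induction_on with
  | empty => simpa using heq
  | insert q Q _ ih =>
    obtain ⟨_, hQS⟩ := Finset.insert_subset_iff.mp hQ
    obtain ⟨hqB, hBQ⟩ := Finset.disjoint_insert_right.mp hdisj
    have hmem : ∀ J, (J, B) ∈ T → (J \ Q, B) ∈ LinkTiling.deletion T Q := fun J hJ =>
      ⟨(J, B), hJ, by simp [Finset.sdiff_eq_self_of_disjoint hBQ]⟩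
    refine ih hQS hBQ ((h.deletion hQS).eq_of_sdiff_singleton_eq (q := q)
      (forall_mem_image.mpr fun t ht => (Finset.card_le_card Finset.sdiff_subset).trans
        (hcard t ht)) (hmem I hI) (hmem I' hI') hqB ?_)
    simpa only [Finset.insert_eq, Finset.union_comm {q}, ← Finset.sup_eq_union, sdiff_sdiff_left]
      using heq

end IsZonotopeSection

end ZonotopeSection

section Lift

variable {ι : Type*} {d : ℕ} {a : ι → EuclideanSpace ℝ (Fin d)}

theorem linearIndepOn_lift {B : Finset ι} (hB : AffineIndependent ℝ (fun b : B => a b)) :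
    LinearIndepOn ℝ (lift ∘ a) (B : Set ι) := by
  refine linearIndepOn_finset_iff.mpr fun γ hγ b hb => ?_
  rw [← Finset.sum_coe_sort] at hγ
  obtain ⟨hfst, hsnd⟩ := Prod.ext_iff.mp hγ
  simp only [comp_apply, lift, Prod.fst_sum, Prod.snd_sum, Prod.smul_fst, Prod.smul_snd,
    smul_eq_mul, mul_one, Prod.fst_zero, Prod.snd_zero] at hfst hsnd
  exact affineIndependent_iff.mp hB Finset.univ (fun b => γ b) hsnd hfst ⟨b, hb⟩
    (Finset.mem_univ _)

variable [Fintype ι]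

theorem linearCombination_lift_eq_smul_iff {γ : ι → ℝ} {c : ℝ} {p : EuclideanSpace ℝ (Fin d)} :
    linearCombination ℝ (lift ∘ a) γ = c • lift p ↔ ∑ i, γ i • a i = c • p ∧ ∑ i, γ i = c := by
  rw [Fintype.linearCombination_apply, Prod.ext_iff, Prod.fst_sum, Prod.snd_sum]
  simp [lift]

theorem smul_lift_mem_image_cube_iff {B : Finset ι} {c : ℝ} (hc : 0 < c) (hc1 : c ≤ 1)
    {p : EuclideanSpace ℝ (Fin d)} :
    c • lift p ∈ linearCombination ℝ (lift ∘ a) '' cube ∅ B ↔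
      p ∈ convexHull ℝ (a '' (B : Set ι)) := by
  classical
  constructor
  · rintro ⟨γ, hγ, hL⟩
    obtain ⟨hfst, hsnd⟩ := linearCombination_lift_eq_smul_iff.mp hL
    have hoff : ∀ i ∉ B, γ i = 0 := fun i hi => ((mem_cube.mp hγ i).2 hi).2 (by simp)
    rw [← Finset.sum_subset (Finset.subset_univ B) fun i _ hi => by rw [hoff i hi, zero_smul]]
      at hfst
    rw [← Finset.sum_subset (Finset.subset_univ B) fun i _ hi => hoff i hi] at hsnd
    have hp : p = B.centerMass γ a := by
      rw [Finset.centerMass, hsnd, hfst, inv_smul_smul₀ hc.ne']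
    rw [hp]
    exact B.centerMass_mem_convexHull (fun i _ => (mem_cube.mp hγ i).1.1) (hsnd ▸ hc)
      fun i hi => mem_image_of_mem a hi
  · intro hp
    have hconv : Convex ℝ {p | c • lift p ∈ linearCombination ℝ (lift ∘ a) '' cube ∅ B} := by
      intro x hx y hy s t hs ht hst
      have : c • lift (s • x + t • y) = s • c • lift x + t • c • lift y := by
        ext1
        · simp only [lift, Prod.smul_fst, Prod.fst_add]
          module
        · simp only [lift, Prod.smul_snd, Prod.snd_add, smul_eq_mul]
          linear_combination (-c) * hst
      simpa only [mem_ofPred_eq, this] using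
        ((convex_cube ∅ B).linear_image (linearCombination ℝ (lift ∘ a))) hx hy hs ht hst
    refine convexHull_min (forall_mem_image.mpr fun b hb => ?_) hconv hp
    refine ⟨Pi.single b c, mem_cube.mpr fun i => ?_, Fintype.linearCombination_apply_single ..⟩
    rcases eq_or_ne i b with rfl | hi
    · simpa [hc.le, hc1] using fun h => absurd (Finset.mem_coe.mp hb) h
    · simp [hi]

end Lift

section Tiling

variable {d n : ℕ} {a : Fin n → EuclideanSpace ℝ (Fin d)}

theorem tile_eq_image {I B : Finset (Fin n)} (h : Disjoint I B) :
    tile a I B = linearCombination ℝ (lift ∘ a) '' cube I B := by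
  have hsum : ∀ γ ∈ cube I B, linearCombination ℝ (lift ∘ a) γ =
      ∑ i ∈ I, lift (a i) + ∑ b ∈ B, γ b • lift (a b) := by
    intro γ hγ
    rw [Fintype.linearCombination_apply, ← Finset.sum_subset (Finset.subset_univ (I ∪ B)),
      Finset.sum_union h]
    · congr 1
      refine Finset.sum_congr rfl fun i hi => ?_
      rw [((mem_cube.mp hγ i).2 (Finset.disjoint_left.mp h hi)).1 hi, one_smul, comp_apply]
    · intro i _ hi
      rw [Finset.mem_union, not_or] at hi
      rw [((mem_cube.mp hγ i).2 hi.2).2 hi.1, zero_smul]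
  ext x
  constructor
  · rintro ⟨α, hα, rfl⟩
    have hγ : B.piecewise α ((I : Set (Fin n)).indicator 1) ∈ cube I B := mem_cube.mpr fun i => by
      by_cases hB : i ∈ B
      · simpa [hB] using hα i hB
      · by_cases hI : i ∈ I <;> simp [hB, hI]
    refine ⟨_, hγ, (hsum _ hγ).trans ?_⟩
    congr 1
    exact Finset.sum_congr rfl fun b hb => by rw [Finset.piecewise_eq_of_mem _ _ _ hb]
  · rintro ⟨γ, hγ, rfl⟩
    exact ⟨γ, fun b _ => (mem_cube.mp hγ b).1, hsum γ hγ⟩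

theorem zonotope_eq_image (a : Fin n → EuclideanSpace ℝ (Fin d)) :
    zonotope a = linearCombination ℝ (lift ∘ a) '' cube ∅ Finset.univ := by
  ext x
  simp [zonotope, mem_cube, Fintype.linearCombination_apply, eq_comm]

theorem IsTileFace.cube_subset {J C I B : Finset (Fin n)} (h : IsTileFace J C I B) :
    cube J C ⊆ cube I B := by
  obtain ⟨hCB, hIJ, hJ, -⟩ := h
  refine cube_subset_cube (fun i hi => ⟨hIJ hi.1, fun hiC => hi.2 (hCB hiC)⟩) ?_
  rw [← Finset.coe_union, ← Finset.coe_union, Finset.coe_subset]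
  exact Finset.union_subset hJ (hCB.trans Finset.subset_union_right)

/-- The tiles that survive the deletion of `Q` as tiles at the origin: those in `ℰ^(r)(Q)` for
some `r`. -/
def survivingTiles (P : Set (Finset (Fin n) × Finset (Fin n))) (Q : Finset (Fin n)) :
    Set (Finset (Fin n) × Finset (Fin n)) :=
  {t ∈ P | Disjoint t.2 Q ∧ t.1 ⊆ Q}

variable {P : Set (Finset (Fin n) × Finset (Fin n))} {Q : Finset (Fin n)} {r : ℕ}
  {t t' : Finset (Fin n) × Finset (Fin n)}

theorem mem_linkTiles : t ∈ linkTiles P Q r ↔ t ∈ survivingTiles P Q ∧ t.1.card = r := by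
  simp only [linkTiles, survivingTiles, mem_ofPred_eq]
  tauto

theorem iUnion_linkTiles (P : Set (Finset (Fin n) × Finset (Fin n))) (Q : Finset (Fin n)) :
    ⋃ r, linkTiles P Q r = survivingTiles P Q := by
  ext t
  simp [mem_linkTiles]

theorem iUnion_regionE (a : Fin n → EuclideanSpace ℝ (Fin d))
    (P : Set (Finset (Fin n) × Finset (Fin n))) (Q : Finset (Fin n)) :
    ⋃ r, regionE a P Q r = ⋃ t ∈ survivingTiles P Q, convexHull ℝ (a '' (t.2 : Set (Fin n))) := by
  simp only [regionE, ← iUnion_linkTiles, biUnion_iUnion]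

theorem linkSimplices_eq_image (a : Fin n → EuclideanSpace ℝ (Fin d))
    (P : Set (Finset (Fin n) × Finset (Fin n))) (Q : Finset (Fin n)) (r : ℕ) :
    linkSimplices a P Q r =
      (fun t => convexHull ℝ (a '' (t.2 : Set (Fin n)))) '' linkTiles P Q r := by
  ext Δ
  simp only [linkSimplices, mem_ofPred_eq, mem_image, eq_comm]

theorem cube_subset_cubes_deletion (ht : t ∈ survivingTiles P Q) :
    cube ∅ t.2 ⊆ cubes (deletion P Q) := by
  refine fun γ hγ => mem_cubes.mpr ⟨_, mem_image_of_mem _ ht.1, ?_⟩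
  rwa [Finset.sdiff_eq_empty_iff_subset.mpr ht.2.2, Finset.sdiff_eq_self_of_disjoint ht.2.1]

namespace IsFineZonotopalTiling

theorem isZonotopeSection (hP : IsFineZonotopalTiling a P) :
    IsZonotopeSection (lift ∘ a) Finset.univ P where
  linearIndepOn t ht := linearIndepOn_lift (hP.affineIndependent t ht)
  subset t _ := ⟨Finset.subset_univ _, Finset.subset_univ _⟩
  surjOn := by
    rw [← zonotope_eq_image, ← hP.cover]
    refine iUnion₂_subset fun t ht => ?_
    rw [tile_eq_image (hP.disjoint t ht)]
    exact image_mono fun γ hγ => mem_cubes.mpr ⟨t, ht, hγ⟩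
  injOn := by
    intro γ hγ δ hδ hL
    obtain ⟨t, ht, hγt⟩ := mem_cubes.mp hγ
    obtain ⟨t', ht', hδt'⟩ := mem_cubes.mp hδ
    have hx : linearCombination ℝ (lift ∘ a) γ ∈ tile a t.1 t.2 ∩ tile a t'.1 t'.2 := by
      rw [tile_eq_image (hP.disjoint t ht), tile_eq_image (hP.disjoint t' ht')]
      exact ⟨mem_image_of_mem _ hγt, hL ▸ mem_image_of_mem _ hδt'⟩
    obtain hempty | ⟨J, C, hface, hface', hinter⟩ := hP.face_to_face t ht t' ht'
    · rw [hempty] at hx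
      exact hx.elim
    · rw [hinter, tile_eq_image hface.2.2.2] at hx
      obtain ⟨ε, hε, hεL⟩ := hx
      have hγε : γ = ε := eq_of_linearCombination_eq
        (linearIndepOn_lift (hP.affineIndependent t ht))
        (fun i hi => apply_eq_of_mem_cube hγt (hface.cube_subset hε) hi) hεL.symm
      have hδε : δ = ε := eq_of_linearCombination_eq
        (linearIndepOn_lift (hP.affineIndependent t' ht'))
        (fun i hi => apply_eq_of_mem_cube hδt' (hface'.cube_subset hε) hi)
        (hL.symm.trans hεL.symm)
      rw [hγε, hδε]

theorem isZonotopeSection_deletion (hP : IsFineZonotopalTiling a P) (Q : Finset (Fin n)) :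
    IsZonotopeSection (lift ∘ a) (Finset.univ \ Q) (deletion P Q) :=
  hP.isZonotopeSection.deletion (Finset.subset_univ Q)

theorem convexHull_inter (hP : IsFineZonotopalTiling a P) (ht : t ∈ survivingTiles P Q)
    (ht' : t' ∈ survivingTiles P Q) :
    convexHull ℝ (a '' (t.2 : Set (Fin n))) ∩ convexHull ℝ (a '' (t'.2 : Set (Fin n))) =
      convexHull ℝ (a '' ((t.2 ∩ t'.2 : Finset (Fin n)) : Set (Fin n))) := by
  ext p
  simp only [mem_inter_iff, ← smul_lift_mem_image_cube_iff zero_lt_one le_rfl]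
  constructor
  · rintro ⟨⟨γ, hγ, hγp⟩, γ', hγ', hγp'⟩
    obtain rfl : γ = γ' := (hP.isZonotopeSection_deletion Q).injOn
      (cube_subset_cubes_deletion ht hγ) (cube_subset_cubes_deletion ht' hγ')
      (hγp.trans hγp'.symm)
    refine ⟨γ, mem_cube.mpr fun i => ⟨(mem_cube.mp hγ i).1, fun hi => ?_⟩, hγp⟩
    rw [Finset.mem_inter, not_and_or] at hi
    exact hi.elim (mem_cube.mp hγ i).2 (mem_cube.mp hγ' i).2
  · exact fun hp => ⟨image_mono (cube_subset_cube (by simp) (by simp)) hp,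
      image_mono (cube_subset_cube (by simp) (by simp)) hp⟩

theorem eq_of_snd_eq (hP : IsFineZonotopalTiling a P) (ht : t ∈ survivingTiles P Q)
    (ht' : t' ∈ survivingTiles P Q) (h : t.2 = t'.2) : t = t' := by
  refine Prod.ext (hP.isZonotopeSection.eq_of_sdiff_eq (B := t.2) (Finset.subset_univ Q)
    (fun u hu => ?_) ht.1 (h ▸ ht'.1) ht.2.1 ?_) h
  · rw [hP.card_eq u hu, hP.card_eq t ht.1]
  · rw [Finset.sdiff_eq_empty_iff_subset.mpr ht.2.2, Finset.sdiff_eq_empty_iff_subset.mpr ht'.2.2]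

theorem sdiff_eq_empty_of_mem_cube_sdiff (hP : IsFineZonotopalTiling a P) (ht : t ∈ P)
    {γ : Fin n → ℝ} (hγ : γ ∈ cube (t.1 \ Q) (t.2 \ Q)) (hsum : ∑ i, γ i < 1) : t.1 \ Q = ∅ := by
  refine Finset.eq_empty_of_forall_notMem fun i hi => hsum.not_ge ?_
  have hiB : i ∉ t.2 \ Q := fun h => Finset.disjoint_left.mp (hP.disjoint t ht)
    (Finset.mem_sdiff.mp hi).1 (Finset.mem_sdiff.mp h).1
  rw [← ((mem_cube.mp hγ i).2 hiB).1 hi]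
  exact Finset.single_le_sum (fun j _ => (mem_cube.mp hγ j).1.1) (Finset.mem_univ i)

theorem exists_mem_convexHull_sdiff (hP : IsFineZonotopalTiling a P)
    {p : EuclideanSpace ℝ (Fin d)} (hp : p ∈ chQ a Q) :
    ∃ t ∈ P, t.1 ⊆ Q ∧ p ∈ convexHull ℝ (a '' ((t.2 \ Q : Finset (Fin n)) : Set (Fin n))) := by
  have hpoints : pointsOff a Q = a '' ((Finset.univ \ Q : Finset (Fin n)) : Set (Fin n)) :=
    congrArg (a '' ·) (by ext; simp)
  -- Below height 1 no coefficient can equal 1, which forces `I ⊆ Q`.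
  have hhalf : (0 : ℝ) < 1 / 2 ∧ (1 / 2 : ℝ) ≤ 1 := by norm_num
  rw [chQ, hpoints, ← smul_lift_mem_image_cube_iff hhalf.1 hhalf.2] at hp
  obtain ⟨γ, hγ, hγp⟩ := (hP.isZonotopeSection_deletion Q).surjOn hp
  obtain ⟨_, ⟨t, ht, rfl⟩, hγt⟩ := mem_cubes.mp hγ
  have hsum : ∑ i, γ i < 1 := by
    rw [(linearCombination_lift_eq_smul_iff.mp hγp).2]
    norm_num
  have hI := hP.sdiff_eq_empty_of_mem_cube_sdiff ht hγt hsum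
  refine ⟨t, ht, Finset.sdiff_eq_empty_iff_subset.mp hI, ?_⟩
  rw [← smul_lift_mem_image_cube_iff hhalf.1 hhalf.2, ← hγp, ← hI]
  exact mem_image_of_mem _ hγt

theorem chQ_subset_iUnion_regionE (hP : IsFineZonotopalTiling a P)
    (h : Q = Finset.univ ∨ affineSpan ℝ (pointsOff a Q) = ⊤) :
    chQ a Q ⊆ ⋃ r, regionE a P Q r := by
  rcases h with rfl | hspan
  · simp [chQ, pointsOff]
  rw [iUnion_regionE]
  refine subset_of_convex_of_subset_union (convex_convexHull ℝ _)
    (interior_convexHull_nonempty_iff_affineSpan_eq_top.mpr hspan)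
    (N := ⋃ t ∈ {t ∈ P | ¬Disjoint t.2 Q},
      convexHull ℝ (a '' ((t.2 \ Q : Finset (Fin n)) : Set (Fin n)))) ?_ ?_ fun p hp => ?_
  · exact (toFinite _).isClosed_biUnion fun t _ =>
      ((t.2.finite_toSet.image a).isCompact_convexHull ℝ).isClosed
  · refine interior_biUnion_convexHull_eq_empty (toFinite _).countable fun t ht =>
      affineSpan_image_ne_top a ?_
    have hlt : (t.2 \ Q).card < t.2.card :=
      Finset.card_lt_card (sdiff_lt_left.mpr fun h => ht.2 h.symm)
    rw [hP.card_eq t ht.1] at hlt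
    rwa [finrank_euclideanSpace_fin, ← Nat.lt_succ_iff]
  · obtain ⟨t, ht, htQ, hpt⟩ := hP.exists_mem_convexHull_sdiff hp
    by_cases hdisj : Disjoint t.2 Q
    · rw [Finset.sdiff_eq_self_of_disjoint hdisj] at hpt
      exact Or.inl (mem_biUnion (x := t) ⟨ht, hdisj, htQ⟩ hpt)
    · exact Or.inr (mem_biUnion (x := t) ⟨ht, hdisj⟩ hpt)

theorem isTriangulation (hP : IsFineZonotopalTiling a P)
    {T : Set (Finset (Fin n) × Finset (Fin n))} (hT : T ⊆ survivingTiles P Q) :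
    IsTriangulation (pointsOff a Q) (⋃ t ∈ T, convexHull ℝ (a '' (t.2 : Set (Fin n))))
      ((fun t => convexHull ℝ (a '' (t.2 : Set (Fin n)))) '' T) := by
  classical
  have hsub : ∀ t ∈ T, ((t.2.image a : Finset _) : Set (EuclideanSpace ℝ (Fin d))) ⊆
      pointsOff a Q := fun t ht => by
    rw [Finset.coe_image]
    exact image_mono fun i hi => Finset.disjoint_left.mp (hT ht).2.1 hi
  have hrange : ∀ B : Finset (Fin n), range (fun b : B => a b) = a '' (B : Set (Fin n)) :=
    fun B => by simp [image_eq_range]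
  refine ⟨⟨forall_mem_image.mpr fun t ht => ?_, forall_mem_image.mpr fun t ht => ?_,
    sUnion_image _ _, forall_mem_image.mpr fun t ht => forall_mem_image.mpr fun t' ht' => ?_⟩,
    forall_mem_image.mpr fun t ht => ?_⟩
  · exact ⟨t.2.image a, hsub t ht, by rw [Finset.coe_image]⟩
  · rw [affineSpan_convexHull, ← hrange,
      (hP.affineIndependent t (hT ht).1).affineSpan_eq_top_iff_card_eq_finrank_add_one]
    simp [hP.card_eq t (hT ht).1]
  · rw [hP.convexHull_inter (hT ht) (hT ht')]
    exact ⟨isExposed_convexHull_image_of_affineIndependent (hP.affineIndependent t (hT ht).1)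
      (Finset.coe_subset.mpr Finset.inter_subset_left),
      isExposed_convexHull_image_of_affineIndependent (hP.affineIndependent t' (hT ht').1)
      (Finset.coe_subset.mpr Finset.inter_subset_right)⟩
  · refine ⟨t.2.image a, hsub t ht, ?_, by rw [Finset.coe_image]⟩
    refine (hP.affineIndependent t (hT ht).1).range.mono ?_
    rw [hrange, Finset.coe_image]

theorem isTriangulation_regionE (hP : IsFineZonotopalTiling a P) (Q : Finset (Fin n)) (r : ℕ) :
    IsTriangulation (pointsOff a Q) (regionE a P Q r) (linkSimplices a P Q r) := by
  rw [linkSimplices_eq_image]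
  exact hP.isTriangulation fun t ht => (mem_linkTiles.mp ht).1

theorem iUnion_regionE_eq_chQ (hP : IsFineZonotopalTiling a P)
    (h : Q = Finset.univ ∨ affineSpan ℝ (pointsOff a Q) = ⊤) :
    ⋃ r, regionE a P Q r = chQ a Q := by
  refine Subset.antisymm ?_ (hP.chQ_subset_iUnion_regionE h)
  rw [iUnion_regionE]
  exact iUnion₂_subset fun t ht =>
    convexHull_mono (image_mono fun i hi => Finset.disjoint_left.mp ht.2.1 hi)

theorem isTriangulation_chQ (hP : IsFineZonotopalTiling a P)
    (h : Q = Finset.univ ∨ affineSpan ℝ (pointsOff a Q) = ⊤) :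
    IsTriangulation (pointsOff a Q) (chQ a Q) (⋃ r, linkSimplices a P Q r) := by
  simp only [← hP.iUnion_regionE_eq_chQ h, iUnion_regionE, linkSimplices_eq_image, ← image_iUnion,
    iUnion_linkTiles]
  exact hP.isTriangulation subset_rfl

theorem card_inter_le_of_ne (hP : IsFineZonotopalTiling a P) (ht : t ∈ survivingTiles P Q)
    (ht' : t' ∈ survivingTiles P Q) (hne : t ≠ t') : (t.2 ∩ t'.2).card ≤ d := by
  by_contra! hlt
  have hleft : t.2 ∩ t'.2 = t.2 := Finset.eq_of_subset_of_card_le Finset.inter_subset_left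
    (by rwa [hP.card_eq t ht.1])
  have hright : t.2 ∩ t'.2 = t'.2 := Finset.eq_of_subset_of_card_le Finset.inter_subset_right
    (by rwa [hP.card_eq t' ht'.1])
  exact hne (hP.eq_of_snd_eq ht ht' (hleft.symm.trans hright))

theorem disjoint_interior_regionE (hP : IsFineZonotopalTiling a P) (Q : Finset (Fin n))
    {r s : ℕ} (hrs : r ≠ s) :
    Disjoint (interior (regionE a P Q r)) (interior (regionE a P Q s)) := by
  have hinter : regionE a P Q r ∩ regionE a P Q s ⊆ ⋃ u ∈ linkTiles P Q r ×ˢ linkTiles P Q s,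
      convexHull ℝ (a '' ((u.1.2 ∩ u.2.2 : Finset (Fin n)) : Set (Fin n))) := by
    rintro p ⟨hp, hp'⟩
    obtain ⟨t, ht, hpt⟩ := mem_iUnion₂.mp hp
    obtain ⟨t', ht', hpt'⟩ := mem_iUnion₂.mp hp'
    refine mem_biUnion (mk_mem_prod ht ht') ?_
    rw [← hP.convexHull_inter (mem_linkTiles.mp ht).1 (mem_linkTiles.mp ht').1]
    exact ⟨hpt, hpt'⟩
  rw [disjoint_iff_inter_eq_empty, ← interior_inter, ← subset_empty_iff]
  refine (interior_mono hinter).trans_eq (interior_biUnion_convexHull_eq_empty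
    (toFinite _).countable fun ⟨t, t'⟩ ⟨ht, ht'⟩ => affineSpan_image_ne_top a ?_)
  obtain ⟨hts, htr⟩ := mem_linkTiles.mp ht
  obtain ⟨hts', hts's⟩ := mem_linkTiles.mp ht'
  rw [finrank_euclideanSpace_fin]
  exact hP.card_inter_le_of_ne hts hts' fun heq => hrs (by rw [← htr, ← hts's, heq])

end IsFineZonotopalTiling

end Tiling

end LinkTiling

theorem proposition3 {d n : ℕ} (a : Fin n → EuclideanSpace ℝ (Fin d))
    (ha : affineSpan ℝ (Set.range a) = ⊤)
    (P : Set (Finset (Fin n) × Finset (Fin n)))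
    (hP : LinkTiling.IsFineZonotopalTiling a P)
    (Q : Finset (Fin n)) :
    (∀ r : ℕ, LinkTiling.IsTriangulation (LinkTiling.pointsOff a Q)
      (LinkTiling.regionE a P Q r) (LinkTiling.linkSimplices a P Q r)) ∧
    ((Q = Finset.univ ∨ affineSpan ℝ (LinkTiling.pointsOff a Q) = ⊤) →
      LinkTiling.IsRegionSubdivision (LinkTiling.pointsOff a Q)
        (LinkTiling.chQ a Q) (fun r => LinkTiling.regionE a P Q r) ∧
      LinkTiling.IsTriangulation (LinkTiling.pointsOff a Q)
        (LinkTiling.chQ a Q) (⋃ r : ℕ, LinkTiling.linkSimplices a P Q r)) ∧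
    LinkTiling.IsTriangulation (LinkTiling.pointsOff a Q)
      (LinkTiling.linkRegion a P Q) (LinkTiling.linkSimplices a P Q Q.card) := by
  exact ⟨hP.isTriangulation_regionE Q, fun h => ⟨
    { cover := hP.iUnion_regionE_eq_chQ h
      disjoint_interior := fun _ _ hrs => hP.disjoint_interior_regionE Q hrs
      face_to_face := ⟨_, fun r => (hP.isTriangulation_regionE Q r).toIsSubdivision,
        (hP.isTriangulation_chQ h).toIsSubdivision⟩ },
    hP.isTriangulation_chQ h⟩, hP.isTriangulation_regionE Q Q.card⟩
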